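/- For a group $G$, a prime $p$ and $r \in \{1,2\}$, let $b_r(G;\mathbb{F}_p) = \dim_{\mathbb{F}_p} H_r(G;\mathbb{F}_p)$ (homology with trivial coefficients). Say that $G$ has the $b_2-b_1$ property with respect to $p$ if there is a constant $C$ such that $b_2(H;\mathbb{F}_p) - b_1(H;\mathbb{F}_p) \le C$ for all finite index subgroups $H$ of $G$; for finitely generated $G$, all the numbers $b_1(H;\mathbb{F}_p)$ are finite, and the property includes the finiteness of all the numbers $b_2(H;\mathbb{F}_p)$. Let $s_n(G)$ be the number of subgroups of $G$ of index at most $n$, and let $s_n^{\triangleleft\triangleleft}(G)$ be the number of those that are subnormal, where a subgroup $K$ of $G$ is subnormal if there is a finite sequence of subgroups $G = G_1 \ge G_2 \ge \dots \ge G_r = K$ with each $G_i$ normal in $G_{i-1}$. Let $\log$ denote the natural logarithm. **Theorem 1.1.** Let $G$ be a finitely generated group that has the $b_2-b_1$ property with respect to the prime $2$. Suppose that $$\sup\{\, b_1(H;\mathbb{F}_2) : H \text{ is a finite index subgroup of } G \,\} = \infty.$$ Then, for infinitely many positive integers $n$, $$s_n(G) \;\ge\; s_n^{\triangleleft\triangleleft}(G)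 \;>\; 2^{\,n/(\sqrt{\log n}\,\log\log n)}.$$ -/

import Mathlib

universe u

/-- `bettiNumber p r G` is `b_r(G; 𝔽_p)`, the dimension over `𝔽_p` of the group homology
`H_r(G; 𝔽_p)` with trivial coefficients, as an element of `ℕ∞` (it is `⊤` when the dimension is
infinite). The field `𝔽_p` is lifted to the universe of `G`, as Mathlib's `groupHomology`
requires. -/
noncomputable def bettiNumber (p : ℕ) [Fact p.Prime] (r : ℕ) (G : Type u) [Group G] : ℕ∞ :=
  Cardinal.toENat (Module.rank (ULift.{u} (ZMod p))
    (groupHomology (Rep.trivial (ULift.{u} (ZMod p)) G (ULift.{u} (ZMod p))) r))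

/-- The `b₂ - b₁` property of a group `G` with respect to the prime `p`: the differences
`b₂(H; 𝔽_p) - b₁(H; 𝔽_p)`, for `H` a finite index subgroup of `G`, are uniformly bounded above. -/
def HasB2SubB1Property (p : ℕ) [Fact p.Prime] (G : Type u) [Group G] : Prop :=
  ∃ C : ℕ, ∀ H : Subgroup G, H.FiniteIndex → bettiNumber p 2 H ≤ bettiNumber p 1 H + C

/-- `s_n(G)`: the number of subgroups of `G` of (finite) index at most `n`. Infinite index
subgroups, for which `Subgroup.index` is `0`, are excluded. -/
noncomputable def subgroupCount (G : Type u) [Group G] (n : ℕ) : ℕ :=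
  {H : Subgroup G | H.FiniteIndex ∧ H.index ≤ n}.ncard

/-- The number of subnormal subgroups of `G` of (finite) index at most `n`. -/
noncomputable def subnormalSubgroupCount (G : Type u) [Group G] (n : ℕ) : ℕ :=
  {H : Subgroup G | H.IsSubnormal ∧ H.FiniteIndex ∧ H.index ≤ n}.ncard

/-!
The proof iterates a lower bound for the first Betti number of the kernel `K` of the canonical
surjection from a group `G` onto `H₁(G; 𝔽₂) = 𝔽₂^n`, where `n = b₁(G)`.

By Shapiro's lemma `H₁(K; 𝔽₂) = H₁(G; M)`, where `M` is the space of functions on `𝔽₂^n`, on which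
`G` acts by translations. The Reed–Muller codes (polynomial functions of degree at most `n - j`)
form a filtration of `M` by subrepresentations whose `j`-th graded piece is trivial of dimension
`n.choose j`, and each code is generated by its monomials of top degree. Feeding this filtration
into the long exact sequences of group homology gives, for every `l`,
`(b₁(G) - 1) * n.choose l ≤ b₁(K) + n.choose (l + 1) + (b₂(G) - b₁(G) + 1) * ∑_{i < l} n.choose i`
(`homologyRank_one_ge_of_filtration`, `homologyRank_one_ker_ge`). If `b₂ - b₁` is bounded and `n` is
large, the choice `l = n / 2` and `n.choose (n / 2) ≥ 2 ^ n / √(2 (n + 1))` give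
`b₁(K) ≥ √n / 2 * 2 ^ n` (`exists_normal_homRank_ge`), while `[G : K] = 2 ^ n`.

Iteration from a finite index subgroup with large first Betti number produces a tower of
subgroups, each normal in the preceding one, in which the Betti numbers grow like iterated
exponentials. The starting subgroup need not be subnormal, but intersecting the tower with its
normal core changes Betti numbers by a bounded amount, so there are subnormal subgroups with
arbitrarily large first Betti number (`exists_isSubnormal_homRank_ge`), and a second tower started
from one of these consists of subnormal subgroups. A member `H` of index `N` contains
`2 ^ b₁(H)` subgroups that are kernels of homomorphisms to `𝔽₂`; they are subnormal of index at most
`2 N`. Far down the tower `b₁(H)` exceeds `2 N / (√(log 2N) log log 2N)` (`exists_index_div_lt`).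
-/

open CategoryTheory Module

/-! ### Ranks in exact sequences of group homology -/

section Homology

variable {k G : Type u} [Field k] [Group G]

theorem LinearMap.finrank_range_of_surj {A B : Type*} [AddCommGroup A] [Module k A]
    [AddCommGroup B] [Module k B] {f : A →ₗ[k] B} (h : Function.Surjective f) :
    finrank k f.range = finrank k B := by
  rw [LinearMap.range_eq_top.2 h, finrank_top]

theorem finrank_eq_of_function_exact {A B C : Type*} [AddCommGroup A] [Module k A]
    [AddCommGroup B] [Module k B] [AddCommGroup C] [Module k C] [Module.Finite k B]
    {f : A →ₗ[k] B} {g : B →ₗ[k] C} (h : Function.Exact f g) :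
    finrank k B = finrank k f.range + finrank k g.range := by
  rw [← LinearMap.finrank_range_add_finrank_ker g, h.linearMap_ker_eq, add_comm]

theorem finite_of_function_exact {A B C : Type*} [AddCommGroup A] [Module k A]
    [AddCommGroup B] [Module k B] [AddCommGroup C] [Module k C] [Module.Finite k A]
    [Module.Finite k C]
    {f : A →ₗ[k] B} {g : B →ₗ[k] C} (h : Function.Exact f g) : Module.Finite k B := by
  have h1 : (LinearMap.ker g).FG := by
    rw [h.linearMap_ker_eq]; exact Module.Finite.iff_fg.1 inferInstance
  have h2 : (Submodule.map g ⊤).FG := by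
    rw [← LinearMap.range_eq_map]; exact Module.Finite.iff_fg.1 inferInstance
  exact ⟨Submodule.fg_of_fg_map_of_fg_inf_ker g h2 (by simpa using h1)⟩

variable {X : ShortComplex (Rep.{u} k G)}

theorem groupHomology_exact_δ_map (hX : X.ShortExact) (i : ℕ) :
    Function.Exact (groupHomology.δ hX (i + 1) i rfl).hom
      (groupHomology.map (MonoidHom.id G) X.f i).hom :=
  (ShortComplex.ShortExact.moduleCat_exact_iff_function_exact _).1
    (groupHomology.mapShortComplex₁_exact hX rfl)

theorem groupHomology_exact_map_map (hX : X.ShortExact) (i : ℕ) :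
    Function.Exact (groupHomology.map (MonoidHom.id G) X.f i).hom
      (groupHomology.map (MonoidHom.id G) X.g i).hom :=
  (ShortComplex.ShortExact.moduleCat_exact_iff_function_exact _).1
    (groupHomology.mapShortComplex₂_exact hX i)

theorem groupHomology_exact_map_δ (hX : X.ShortExact) (i : ℕ) :
    Function.Exact (groupHomology.map (MonoidHom.id G) X.g (i + 1)).hom
      (groupHomology.δ hX (i + 1) i rfl).hom :=
  (ShortComplex.ShortExact.moduleCat_exact_iff_function_exact _).1
    (groupHomology.mapShortComplex₃_exact hX rfl)

theorem groupHomology_map_zero_surjective (hX : X.ShortExact) :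
    Function.Surjective (groupHomology.map (MonoidHom.id G) X.g 0).hom := by
  have := hX.epi_g
  exact (ModuleCat.epi_iff_surjective _).1 (groupHomology.epi_map_0_of_epi X.g)

/-- The dimension of `H_i(G; M)`, with the value `0` if it is infinite. -/
noncomputable abbrev homologyRank (M : Rep.{u} k G) (i : ℕ) : ℕ := finrank k (groupHomology M i)

/-- The homology of `M` is finite dimensional in degrees at most two. -/
def FiniteLowHomology (M : Rep.{u} k G) : Prop :=
  ∀ i ≤ 2, Module.Finite k (groupHomology M i)

theorem FiniteLowHomology.extension (hX : X.ShortExact) (h₁ : FiniteLowHomology X.X₁)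
    (h₃ : FiniteLowHomology X.X₃) : FiniteLowHomology X.X₂ := fun i hi ↦ by
  have := h₁ i hi
  have := h₃ i hi
  exact finite_of_function_exact (groupHomology_exact_map_map hX i)

/-- The ranks `a i`, `b i`, `d i` of the maps `H_i(X₁) → H_i(X₂)`, `H_i(X₂) → H_i(X₃)` and
`H_i(X₃) → H_{i-1}(X₁)` account for the dimensions of all terms of the long exact sequence. -/
theorem exists_ranks_of_shortExact (hX : X.ShortExact) (h₁ : FiniteLowHomology X.X₁)
    (h₃ : FiniteLowHomology X.X₃) : ∃ a b d : ℕ → ℕ,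
      a 2 ≤ homologyRank X.X₁ 2 ∧
      homologyRank X.X₂ 2 = a 2 + b 2 ∧ homologyRank X.X₃ 2 = b 2 + d 2 ∧
      homologyRank X.X₁ 1 = d 2 + a 1 ∧ homologyRank X.X₂ 1 = a 1 + b 1 ∧
      homologyRank X.X₃ 1 = b 1 + d 1 ∧ homologyRank X.X₁ 0 = d 1 + a 0 ∧
      homologyRank X.X₂ 0 = a 0 + b 0 ∧ homologyRank X.X₃ 0 = b 0 := by
  have h₂ := FiniteLowHomology.extension hX h₁ h₃
  have := h₁ 0 (by simp)
  have := h₁ 1 (by simp)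
  have := h₁ 2 (by simp)
  have := h₂ 0 (by simp)
  have := h₂ 1 (by simp)
  have := h₂ 2 (by simp)
  have := h₃ 0 (by simp)
  have := h₃ 1 (by simp)
  have := h₃ 2 (by simp)
  refine ⟨fun i ↦ finrank k (groupHomology.map (MonoidHom.id G) X.f i).hom.range,
    fun i ↦ finrank k (groupHomology.map (MonoidHom.id G) X.g i).hom.range,
    fun i ↦ finrank k (groupHomology.δ hX (i - 1 + 1) (i - 1) rfl).hom.range,
    LinearMap.finrank_range_le _,
    finrank_eq_of_function_exact (groupHomology_exact_map_map hX 2),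
    finrank_eq_of_function_exact (groupHomology_exact_map_δ hX 1),
    finrank_eq_of_function_exact (groupHomology_exact_δ_map hX 1),
    finrank_eq_of_function_exact (groupHomology_exact_map_map hX 1),
    finrank_eq_of_function_exact (groupHomology_exact_map_δ hX 0),
    finrank_eq_of_function_exact (groupHomology_exact_δ_map hX 0),
    finrank_eq_of_function_exact (groupHomology_exact_map_map hX 0), ?_⟩
  exact (LinearMap.finrank_range_of_surj (groupHomology_map_zero_surjective hX)).symm

/-- In a short exact sequence `0 → X₁ → X₂ → X₃ → 0`,
`h₁(X₂) ≥ h₁(X₃) - h₀(X₁)`. -/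
theorem homologyRank_one_quotient_le (hX : X.ShortExact)
    [Module.Finite k (groupHomology X.X₂ 1)] [Module.Finite k (groupHomology X.X₃ 1)]
    [Module.Finite k (groupHomology X.X₁ 0)] :
    homologyRank X.X₃ 1 ≤ homologyRank X.X₂ 1 + homologyRank X.X₁ 0 := by
  unfold homologyRank
  rw [finrank_eq_of_function_exact (groupHomology_exact_map_δ hX 0)]
  exact add_le_add (LinearMap.finrank_range_le _) (Submodule.finrank_le _)

/-! ### Trivial coefficients -/

theorem groupHomology_map_add {A B : Rep.{u} k G} (φ ψ : A ⟶ B) (i : ℕ) :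
    groupHomology.map (MonoidHom.id G) (φ + ψ) i =
      groupHomology.map (MonoidHom.id G) φ i + groupHomology.map (MonoidHom.id G) ψ i := by
  have : groupHomology.chainsMap (MonoidHom.id G) (φ + ψ) =
      groupHomology.chainsMap (MonoidHom.id G) φ + groupHomology.chainsMap (MonoidHom.id G) ψ := by
    ext i : 1
    apply ModuleCat.hom_ext
    refine Finsupp.lhom_ext fun x a ↦ ?_
    simp only [groupHomology.chainsMap_id_f_hom_eq_mapRange, HomologicalComplex.add_f_apply,
      ModuleCat.hom_add, LinearMap.add_apply, Finsupp.mapRange.linearMap_apply]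
    rw [Finsupp.mapRange_single, Finsupp.mapRange_single, Finsupp.mapRange_single,
      ← Finsupp.single_add]
    rfl
  exact (congrArg (fun c ↦ HomologicalComplex.homologyMap c i) this).trans
    (HomologicalComplex.homologyMap_add _ _ _)

instance (i : ℕ) : (groupHomology.functor k G i).Additive where
  map_add := groupHomology_map_add _ _ i

instance : (Rep.trivialFunctor k G).Additive where
  map_add := rfl

/-- An additive endofunctor `T` of vector spaces satisfies `T(V) ≅ T(k)^c` for `V` of
dimension `c`. -/
theorem nonempty_linearEquiv_pi_of_additive (T : ModuleCat.{u} k ⥤ ModuleCat.{u} k) [T.Additive]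
    (V : ModuleCat.{u} k) [Module.Finite k V] :
    Nonempty (T.obj V ≃ₗ[k] (Fin (finrank k V) → T.obj (ModuleCat.of k k))) := by
  let e₁ : V ≅ ⨁ fun _ : Fin (finrank k V) ↦ ModuleCat.of k k :=
    (finBasis k V).equivFun.toModuleIso ≪≫
      (ModuleCat.biproductIsoPi fun _ : Fin (finrank k V) ↦ ModuleCat.of k k).symm
  exact ⟨(T.mapIso e₁ ≪≫ T.mapBiproduct _ ≪≫ ModuleCat.biproductIsoPi _).toLinearEquiv⟩

variable (V : Type u) [AddCommGroup V] [Module k V] [Module.Finite k V]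

theorem nonempty_groupHomology_trivial_equiv (i : ℕ) :
    Nonempty (groupHomology (Rep.trivial k G V) i ≃ₗ[k]
      (Fin (finrank k V) → groupHomology (Rep.trivial k G k) i)) :=
  nonempty_linearEquiv_pi_of_additive (Rep.trivialFunctor k G ⋙ groupHomology.functor k G i)
    (ModuleCat.of k V)

theorem FiniteLowHomology.trivial (h : FiniteLowHomology (Rep.trivial k G k)) :
    FiniteLowHomology (Rep.trivial k G V) := fun i hi ↦ by
  have := h i hi
  obtain ⟨e⟩ := nonempty_groupHomology_trivial_equiv (k := k) (G := G) V i
  exact Module.Finite.equiv e.symm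

theorem homologyRank_trivial (h : FiniteLowHomology (Rep.trivial k G k)) {i : ℕ} (hi : i ≤ 2) :
    homologyRank (Rep.trivial k G V) i =
      finrank k V * homologyRank (Rep.trivial k G k) i := by
  have := h i hi
  obtain ⟨e⟩ := nonempty_groupHomology_trivial_equiv (k := k) (G := G) V i
  rw [homologyRank, e.finrank_eq, finrank_pi_fintype]
  simp

/-- `H_0(G; M)` is spanned by the image of any subspace `U` of `M` with `U + I M = M`, where `I` is
the augmentation ideal. -/
theorem homologyRank_zero_le (M : Rep.{u} k G) [Module.Finite k M] (U : Submodule k M)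
    (h : U ⊔ Representation.Coinvariants.ker M.ρ = ⊤) :
    Module.Finite k (groupHomology M 0) ∧ homologyRank M 0 ≤ finrank k U := by
  let π : M →ₗ[k] groupHomology M 0 :=
    (groupHomology.H0Iso M).toLinearEquiv.symm.toLinearMap ∘ₗ Representation.Coinvariants.mk M.ρ
  have hπ : Function.Surjective π :=
    (groupHomology.H0Iso M).toLinearEquiv.symm.surjective.comp
      (Representation.Coinvariants.mk_surjective M.ρ)
  have hfin : Module.Finite k (groupHomology M 0) := Module.Finite.of_surjective π hπ
  refine ⟨hfin, ?_⟩
  have hker : Representation.Coinvariants.ker M.ρ ≤ LinearMap.ker π := by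
    intro x hx
    have : Representation.Coinvariants.mk M.ρ x = 0 :=
      (Representation.Coinvariants.mk_eq_zero M.ρ).2 hx
    simp [π, this]
  have hU : U.map π = ⊤ := by
    have h2 := congrArg (Submodule.map π) h
    rw [Submodule.map_sup, Submodule.map_top, LinearMap.range_eq_top.2 hπ,
      LinearMap.le_ker_iff_map.1 hker, sup_bot_eq] at h2
    exact h2
  rw [homologyRank, ← finrank_top, ← hU]
  exact Submodule.finrank_map_le π U

/-! ### Extensions by trivial representations -/

/-- If `G` acts trivially on the kernel of a surjection `f : B → Q`, then `f` is the second map of a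
short exact sequence starting with a trivial representation. -/
theorem shortExact_trivial_ker {B Q : Rep.{u} k G} (f : B ⟶ Q)
    (hf : Function.Surjective f.hom)
    (htriv : ∀ g : G, ∀ x : B, f.hom x = 0 → B.ρ g x = x) :
    ∃ i : Rep.trivial k G (LinearMap.ker f.hom.toLinearMap) ⟶ B, ∃ w : i ≫ f = 0,
      (ShortComplex.mk i f w).ShortExact := by
  let i : Rep.trivial k G (LinearMap.ker f.hom.toLinearMap) ⟶ B :=
    Rep.ofHom ⟨(LinearMap.ker f.hom.toLinearMap).subtype, fun g ↦ by
      ext x; exact (htriv g x.1 x.2).symm⟩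
  have w : i ≫ f = 0 := by
    ext x
    exact x.2
  refine ⟨i, w, ?_⟩
  have hmono : Mono i := (Rep.mono_iff_injective _).2 Subtype.val_injective
  have hepi : Epi f := (Rep.epi_iff_surjective _).2 hf
  refine { exact := ?_, mono_f := hmono, epi_g := hepi }
  refine (ShortComplex.exact_map_iff_of_faithful _ (forget₂ (Rep k G) (ModuleCat k))).1 ?_
  rw [ShortComplex.moduleCat_exact_iff]
  intro x hx
  exact ⟨⟨x, hx⟩, rfl⟩

theorem homologyRank_zero_trivial : homologyRank (Rep.trivial k G k) 0 = 1 := by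
  rw [homologyRank,
    (groupHomology.H0IsoOfIsTrivial (Rep.trivial k G k)).toLinearEquiv.finrank_eq]
  exact finrank_self k

/-- The map `M ⧸ W' → M ⧸ W` for invariant subspaces `W' ≤ W`. -/
def Rep.quotientFactor (M : Rep.{u} k G) {W W' : Submodule k M} (hle : W' ≤ W)
    (hW : ∀ g, W ≤ W.comap (M.ρ g)) (hW' : ∀ g, W' ≤ W'.comap (M.ρ g)) :
    M.quotient W' hW' ⟶ M.quotient W hW :=
  Rep.ofHom ⟨Submodule.factor hle, fun g ↦ by ext x; rfl⟩

/-- The effect on homology of refining a quotient `M ⧸ W` to `M ⧸ W'` when `W ⧸ W'` is a trivial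
representation: the "Euler characteristic" `h₂ - h₁ + h₀` grows by at most
`dim (W ⧸ W') (b₂ - b₁ + 1)`, and `h₁` is bounded below. -/
theorem homologyRank_quotient_step (M : Rep.{u} k G) [Module.Finite k M]
    {W W' : Submodule k M} (hle : W' ≤ W)
    (hW : ∀ g, W ≤ W.comap (M.ρ g)) (hW' : ∀ g, W' ≤ W'.comap (M.ρ g))
    (htriv : ∀ g, ∀ x ∈ W, M.ρ g x - x ∈ W') {c : ℕ} (hc : finrank k W = finrank k W' + c)
    (hfin : FiniteLowHomology (Rep.trivial k G k)) (hQ : FiniteLowHomology (M.quotient W hW)) :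
    FiniteLowHomology (M.quotient W' hW') ∧
    ((homologyRank (M.quotient W' hW') 2 : ℤ) - homologyRank (M.quotient W' hW') 1 +
        homologyRank (M.quotient W' hW') 0 ≤
      homologyRank (M.quotient W hW) 2 - homologyRank (M.quotient W hW) 1 +
        homologyRank (M.quotient W hW) 0 +
        c * (homologyRank (Rep.trivial k G k) 2 - homologyRank (Rep.trivial k G k) 1 + 1)) ∧
    c * homologyRank (Rep.trivial k G k) 1 + homologyRank (M.quotient W hW) 1 ≤
      homologyRank (M.quotient W' hW') 1 + homologyRank (M.quotient W hW) 2 + c := by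
  set f := M.quotientFactor hle hW hW'
  have hsurj : Function.Surjective f.hom := Submodule.factor_surjective hle
  obtain ⟨i, w, hX⟩ := shortExact_trivial_ker f hsurj (by
    intro g x hx
    obtain ⟨x, rfl⟩ := W'.mkQ_surjective x
    have hxW : x ∈ W := (Submodule.Quotient.mk_eq_zero W).1 hx
    exact (Submodule.Quotient.eq W').2 (htriv g x hxW))
  have hker : finrank k (LinearMap.ker f.hom.toLinearMap) = c := by
    have h1 := LinearMap.finrank_range_add_finrank_ker f.hom.toLinearMap
    rw [LinearMap.range_eq_top.2 hsurj, finrank_top] at h1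
    have h2 := Submodule.finrank_quotient_add_finrank W
    have h3 := Submodule.finrank_quotient_add_finrank W'
    have h1' : finrank k (M ⧸ W) + finrank k (LinearMap.ker f.hom.toLinearMap) =
      finrank k (M ⧸ W') := h1
    omega
  have hfinA := hfin.trivial (LinearMap.ker f.hom.toLinearMap)
  have r0 := homologyRank_trivial (LinearMap.ker f.hom.toLinearMap) hfin (i := 0) (by simp)
  have r1 := homologyRank_trivial (LinearMap.ker f.hom.toLinearMap) hfin (i := 1) (by simp)
  have r2 := homologyRank_trivial (LinearMap.ker f.hom.toLinearMap) hfin (i := 2) (by simp)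
  rw [homologyRank_zero_trivial, hker, mul_one] at r0
  rw [hker] at r1 r2
  refine ⟨FiniteLowHomology.extension hX hfinA hQ, ?_⟩
  obtain ⟨a, b, d, e1, e2, e3, e4, e5, e6, e7, e8, e9⟩ := exists_ranks_of_shortExact hX hfinA hQ
  dsimp only at e1 e2 e3 e4 e5 e6 e7 e8 e9
  rw [r2] at e1
  rw [r1] at e4
  rw [r0] at e7
  constructor
  · have e1' : (a 2 : ℤ) ≤ c * homologyRank (Rep.trivial k G k) 2 := by exact_mod_cast e1
    have e4' : (c * homologyRank (Rep.trivial k G k) 1 : ℤ) = d 2 + a 1 := by exact_mod_cast e4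
    rw [mul_add, mul_sub, mul_one, e4', e2, e3, e5, e6, e8, e9]
    have e7' : (c : ℤ) = d 1 + a 0 := by exact_mod_cast e7
    push_cast
    linarith
  · rw [e4, e5, e6, e3, e7]
    omega

/-- A lower bound for `h₁(M)` from a filtration `M = W₀ ≥ W₁ ≥ ⋯` with trivial graded pieces of
dimensions `c i`: bound `h₁(M ⧸ W (l + 1))` from below by refining quotients, and lift to `M` at the
cost of `h₀(W (l + 1))`. The last hypothesis says that the subspace `U` generates `W (l + 1)` as a
representation, so that `h₀(W (l + 1)) ≤ dim U`. -/
theorem homologyRank_one_ge_of_filtration (M : Rep.{u} k G) [Module.Finite k M]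
    (W : ℕ → Submodule k M) (hW0 : W 0 = ⊤) (hle : ∀ j, W (j + 1) ≤ W j)
    (htriv : ∀ j g, ∀ x ∈ W j, M.ρ g x - x ∈ W (j + 1)) (c : ℕ → ℕ)
    (hc : ∀ j, finrank k (W j) = finrank k (W (j + 1)) + c j)
    (hfin : FiniteLowHomology (Rep.trivial k G k))
    (hM : Module.Finite k (groupHomology M 1)) (l : ℕ) (U : Submodule k M)
    (hU : U ≤ W (l + 1))
    (hUW : ∀ N : Submodule k M, U ≤ N → (∀ g, ∀ x ∈ W (l + 1), M.ρ g x - x ∈ N) →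
      W (l + 1) ≤ N) :
    (homologyRank (Rep.trivial k G k) 1 - 1 : ℤ) * c l ≤
      homologyRank M 1 + finrank k U +
        (homologyRank (Rep.trivial k G k) 2 - homologyRank (Rep.trivial k G k) 1 + 1) *
          ∑ i ∈ Finset.range l, (c i : ℤ) := by
  have hinv (j) (g : G) : W j ≤ (W j).comap (M.ρ g) := fun x hx ↦ by
    have := add_mem (hle j (htriv j g x hx)) hx
    simpa using this
  have key (j : ℕ) : FiniteLowHomology (M.quotient (W j) (hinv j)) ∧
      (homologyRank (M.quotient (W j) (hinv j)) 2 : ℤ) -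
        homologyRank (M.quotient (W j) (hinv j)) 1 +
        homologyRank (M.quotient (W j) (hinv j)) 0 ≤
      (homologyRank (Rep.trivial k G k) 2 - homologyRank (Rep.trivial k G k) 1 + 1) *
          ∑ i ∈ Finset.range j, (c i : ℤ) := by
    induction j with
    | zero =>
      have hz : Limits.IsZero (M.quotient (W 0) (hinv 0)) := by
        rw [Rep.isZero_iff]
        exact Submodule.Quotient.subsingleton_iff.2 hW0
      have hz' (i) : Subsingleton (groupHomology (M.quotient (W 0) (hinv 0)) i) :=
        ModuleCat.subsingleton_of_isZero ((groupHomology.functor k G i).map_isZero hz)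
      refine ⟨fun i _ ↦ inferInstance, ?_⟩
      simp [homologyRank, finrank_zero_of_subsingleton]
    | succ j ih =>
      obtain ⟨h1, h2, -⟩ := homologyRank_quotient_step M (hle j) (hinv j) (hinv (j + 1))
        (htriv j) (hc j) hfin ih.1
      refine ⟨h1, h2.trans ?_⟩
      rw [Finset.sum_range_succ, mul_add]
      linarith [ih.2]
  obtain ⟨hf1, -, h3⟩ := homologyRank_quotient_step M (hle l) (hinv l) (hinv (l + 1))
    (htriv l) (hc l) hfin (key l).1
  have h4 := (key l).2
  -- the short exact sequence `0 → W (l + 1) → M → M ⧸ W (l + 1) → 0`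
  let S := M.subrepresentation (W (l + 1)) (hinv (l + 1))
  let ι := M.subtype (W (l + 1)) (hinv (l + 1))
  let π := M.mkQ (W (l + 1)) (hinv (l + 1))
  have w : ι ≫ π = 0 := by
    ext x
    exact (Submodule.Quotient.mk_eq_zero _).2 x.2
  have hX : (ShortComplex.mk ι π w).ShortExact :=
    { exact := (ShortComplex.exact_map_iff_of_faithful _
        (forget₂ (Rep k G) (ModuleCat k))).1 <| (ShortComplex.moduleCat_exact_iff _).2 fun x hx ↦
          ⟨⟨x, (Submodule.Quotient.mk_eq_zero _).1 hx⟩, rfl⟩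
      mono_f := (Rep.mono_iff_injective _).2 Subtype.val_injective
      epi_g := (Rep.epi_iff_surjective _).2 (Submodule.mkQ_surjective _) }
  have hS := homologyRank_zero_le S (U.comap (W (l + 1)).subtype) (by
    have := hUW ((U.comap (W (l + 1)).subtype ⊔
      Representation.Coinvariants.ker S.ρ).map (W (l + 1)).subtype) (by
        rw [Submodule.map_sup, Submodule.map_comap_subtype, inf_eq_right.2 hU]
        exact le_sup_left) (by
        intro g x hx
        exact ⟨S.ρ g ⟨x, hx⟩ - ⟨x, hx⟩, Submodule.mem_sup_right
          (Representation.Coinvariants.sub_mem_ker g _), rfl⟩)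
    rw [eq_top_iff]
    intro x _
    obtain ⟨y, hy, hyx⟩ := this x.2
    rwa [← Subtype.val_injective hyx])
  have hU' : finrank k (U.comap (W (l + 1)).subtype) = finrank k U :=
    (Submodule.comapSubtypeEquivOfLe hU).finrank_eq
  have := hS.1
  have := hf1 1 (by simp)
  have h5 := homologyRank_one_quotient_le hX
  dsimp only at h5
  have h6 := hS.2
  rw [hU'] at h6
  have h3' : (c l * homologyRank (Rep.trivial k G k) 1 : ℤ) +
    homologyRank (M.quotient (W l) (hinv l)) 1 ≤
      homologyRank (M.quotient (W (l + 1)) (hinv (l + 1))) 1 +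
        homologyRank (M.quotient (W l) (hinv l)) 2 + c l := by exact_mod_cast h3
  have h5' : (homologyRank (M.quotient (W (l + 1)) (hinv (l + 1))) 1 : ℤ) ≤
    homologyRank M 1 + homologyRank S 0 := by exact_mod_cast h5
  have h6' : (homologyRank S 0 : ℤ) ≤ finrank k U := by exact_mod_cast h6
  have h7 : (0 : ℤ) ≤ homologyRank (M.quotient (W l) (hinv l)) 0 := by positivity
  rw [sub_mul, mul_comm (homologyRank (Rep.trivial k G k) 1 : ℤ)]
  linarith

end Homology

/-! ### Functions on an elementary abelian quotient -/

section Translation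

variable {k G : Type u} [Field k] [Group G] {ι : Type}

/-- The representation of `G` on the functions on `k^ι` in which `g` acts as translation by `f g`.
It is coinduced from the trivial representation of the kernel of `f` when `f` is surjective. -/
def translationRepresentation (f : G →* Multiplicative (ι → k)) :
    Representation k G ((ι → k) → k) where
  toFun g := LinearMap.funLeft k k fun x ↦ x + (f g).toAdd
  map_one' := by ext; simp [LinearMap.funLeft]
  map_mul' g h := by
    refine LinearMap.ext fun v ↦ funext fun x ↦ ?_
    simp [LinearMap.funLeft_apply, add_assoc]

theorem nonempty_translation_equiv_coind (f : G →* Multiplicative (ι → k))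
    (hf : Function.Surjective f) :
    Nonempty (Rep.of (translationRepresentation f) ≅
      Rep.coind f.ker.subtype (Rep.trivial k f.ker k)) := by
  let F : ((ι → k) → k) →ₗ[k]
      Representation.coindV f.ker.subtype (Representation.trivial k f.ker k) :=
    LinearMap.codRestrict _ (LinearMap.funLeft k k fun g ↦ (f g).toAdd) (by
      intro v g h
      have : f (g : G) = 1 := g.2
      simp [LinearMap.funLeft_apply, this])
  have hFapp (v : (ι → k) → k) (g : G) : (F v).1 g = v (f g).toAdd := rfl
  have hF : Function.Bijective F := by
    constructor
    · intro v w h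
      funext x
      obtain ⟨g, hg⟩ := hf (Multiplicative.ofAdd x)
      have := congrFun (congrArg Subtype.val h) g
      rw [hFapp, hFapp, hg] at this
      exact this
    · intro w
      choose s hs using hf
      refine ⟨fun x ↦ w.1 (s (Multiplicative.ofAdd x)), Subtype.ext (funext fun g ↦ ?_)⟩
      have hmem : s (f g) * g⁻¹ ∈ f.ker := by simp [MonoidHom.mem_ker, hs]
      have := w.2 ⟨_, hmem⟩ g
      rw [hFapp]
      simpa using this
  refine ⟨Rep.mkIso (.mk (LinearEquiv.ofBijective F hF) fun g ↦ ?_)⟩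
  refine LinearMap.ext fun v ↦ Subtype.ext (funext fun h ↦ ?_)
  change v ((f h).toAdd + (f g).toAdd) = v ((f (h * g)).toAdd)
  simp

/-- Shapiro's lemma for the kernel of a surjection onto a finite elementary abelian group. -/
theorem nonempty_groupHomology_translation_equiv [Finite ι] [Finite k]
    (f : G →* Multiplicative (ι → k)) (hf : Function.Surjective f) (i : ℕ) :
    Nonempty (groupHomology (Rep.of (translationRepresentation f)) i ≃ₗ[k]
      groupHomology (Rep.trivial k f.ker k) i) := by
  classical
  have : f.ker.FiniteIndex := by
    have : Finite f.range := Finite.of_injective _ Subtype.val_injective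
    exact Subgroup.finiteIndex_ker f
  obtain ⟨e⟩ := nonempty_translation_equiv_coind f hf
  exact ⟨((groupHomology.functor k G i).mapIso
    (e ≪≫ (Rep.indCoindIso (Rep.trivial k f.ker k)).symm) ≪≫
      groupHomology.indIso f.ker (Rep.trivial k f.ker k) i).toLinearEquiv⟩

end Translation

/-! ### Reed–Muller codes -/

section ReedMuller

variable {k : Type u} [Field k] {ι : Type}

/-- The squarefree monomial `∏ i ∈ S, x i`, as a function on `k^ι`. -/
def squarefreeMonomial (k : Type u) [Field k] (S : Finset ι) : (ι → k) → k :=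
  fun x ↦ ∏ i ∈ S, x i

/-- The value of the monomial of `T` at the indicator function of `S` is `1` if `T ⊆ S` and `0`
otherwise, which is a unitriangular matrix. -/
theorem linearIndependent_squarefreeMonomial [Fintype ι] :
    LinearIndependent k (squarefreeMonomial k (ι := ι)) := by
  classical
  rw [Fintype.linearIndependent_iff]
  intro c hc S
  induction S using Finset.strongInduction with
  | H S ih =>
    -- evaluate at the indicator function of `S`
    have h := congrFun hc (fun i ↦ if i ∈ S then 1 else 0)
    rw [Finset.sum_apply, Finset.sum_eq_single S] at h
    · have h1 : squarefreeMonomial k S (fun i ↦ if i ∈ S then 1 else 0) = 1 :=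
        Finset.prod_eq_one fun i hi ↦ by simp [hi]
      simpa [h1] using h
    · intro T _ hT
      by_cases hTS : T ⊆ S
      · simp [ih T (hTS.ssubset_of_ne hT)]
      · obtain ⟨i, hiT, hiS⟩ := Finset.not_subset.1 hTS
        have : squarefreeMonomial k T (fun i ↦ if i ∈ S then 1 else 0) = 0 :=
          Finset.prod_eq_zero hiT (by simp [hiS])
        simp [this]
    · simp

/-- The span of the squarefree monomials indexed by `A`. -/
def monomialSpan (k : Type u) [Field k] (A : Set (Finset ι)) : Submodule k ((ι → k) → k) :=
  Submodule.span k (squarefreeMonomial k '' A)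

theorem monomialSpan_mono {A B : Set (Finset ι)} (h : A ⊆ B) :
    monomialSpan k A ≤ monomialSpan k B :=
  Submodule.span_mono (Set.image_mono h)

theorem squarefreeMonomial_mem {A : Set (Finset ι)} {S : Finset ι} (h : S ∈ A) :
    squarefreeMonomial k S ∈ monomialSpan k A :=
  Submodule.subset_span ⟨S, h, rfl⟩

theorem finrank_monomialSpan [Fintype ι] (A : Finset (Finset ι)) :
    finrank k (monomialSpan k (A : Set (Finset ι))) = A.card := by
  classical
  have h : LinearIndependent k (fun S : A ↦ squarefreeMonomial k (S : Finset ι)) :=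
    linearIndependent_squarefreeMonomial.comp _ Subtype.val_injective
  have := finrank_span_eq_card h
  rw [show (fun S : A ↦ squarefreeMonomial k (S : Finset ι)) =
    squarefreeMonomial k ∘ fun S : A ↦ (S : Finset ι) from rfl, Set.range_comp] at this
  have hA : Set.range (fun S : A ↦ (S : Finset ι)) = A := by ext; simp
  rw [hA, Fintype.card_coe] at this
  exact this

theorem finrank_monomialSpan_filter [Fintype ι] (p : Finset ι → Prop) [DecidablePred p] :
    finrank k (monomialSpan k {S | p S}) = (Finset.univ.filter p).card := by
  have h : {S | p S} = (Finset.univ.filter p : Set (Finset ι)) := by ext S; simp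
  rw [h, finrank_monomialSpan]

theorem monomialSpan_univ [Fintype ι] (hk : Nat.card k = 2) :
    monomialSpan k (Set.univ : Set (Finset ι)) = ⊤ := by
  have : Finite k := Nat.finite_of_card_ne_zero (by simp [hk])
  have := Fintype.ofFinite k
  classical
  apply Submodule.eq_top_of_finrank_eq
  have := finrank_monomialSpan (k := k) (Finset.univ : Finset (Finset ι))
  rw [Finset.coe_univ] at this
  rw [this, finrank_pi, Finset.card_univ, Fintype.card_finset, Fintype.card_fun,
    Fintype.card_eq_nat_card (α := k), hk, Fintype.card_eq_nat_card]

/-- Translating a monomial changes it by a combination of monomials of smaller degree. -/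
theorem squarefreeMonomial_translate_sub (S : Finset ι) (a : ι → k) :
    LinearMap.funLeft k k (fun x ↦ x + a) (squarefreeMonomial k S) - squarefreeMonomial k S ∈
      monomialSpan k {T | T.card < S.card} := by
  classical
  have h : LinearMap.funLeft k k (fun x ↦ x + a) (squarefreeMonomial k S) -
      squarefreeMonomial k S =
      ∑ T ∈ S.ssubsets, (∏ i ∈ S \ T, a i) • squarefreeMonomial k T := by
    funext x
    have : (∏ i ∈ S, (x i + a i)) =
        ∑ T ∈ S.ssubsets, (∏ i ∈ S \ T, a i) * ∏ i ∈ T, x i + ∏ i ∈ S, x i := by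
      rw [Finset.prod_add, Finset.ssubsets,
        ← Finset.sum_erase_add _ _ (Finset.mem_powerset_self S)]
      simp [mul_comm]
    simp [LinearMap.funLeft_apply, squarefreeMonomial, this]
  rw [h]
  refine Submodule.sum_mem _ fun T hT ↦ Submodule.smul_mem _ _ (squarefreeMonomial_mem ?_)
  exact Finset.card_lt_card (Finset.mem_ssubsets.1 hT)

theorem squarefreeMonomial_insert_translate_sub [DecidableEq ι] {S : Finset ι} {i : ι}
    (hi : i ∉ S) :
    LinearMap.funLeft k k (fun x ↦ x + Pi.single i 1) (squarefreeMonomial k (insert i S)) -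
      squarefreeMonomial k (insert i S) = squarefreeMonomial k S := by
  funext x
  have : ∏ j ∈ S, (x j + (Pi.single i 1 : ι → k) j) = ∏ j ∈ S, x j :=
    Finset.prod_congr rfl fun j hj ↦ by
      rw [Pi.single_eq_of_ne (by rintro rfl; exact hi hj), add_zero]
  simp [LinearMap.funLeft_apply, squarefreeMonomial, Finset.prod_insert hi, this]
  ring

/-- The number of subsets whose complement has `j` elements. -/
theorem card_filter_card_add_eq [Fintype ι] (j : ℕ) :
    (Finset.univ.filter fun S : Finset ι ↦ S.card + j = Fintype.card ι).card =
      (Fintype.card ι).choose j := by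
  by_cases hj : j ≤ Fintype.card ι
  · rw [← Nat.choose_symm hj, ← Finset.card_univ, ← Finset.card_powersetCard]
    congr 1
    ext S
    simp only [Finset.mem_filter, Finset.mem_univ, true_and, Finset.mem_powersetCard,
      Finset.subset_univ]
    rw [Finset.card_univ]
    omega
  · rw [Nat.choose_eq_zero_of_lt (by omega), Finset.card_eq_zero, Finset.filter_eq_empty_iff]
    intro S _
    omega

variable (k ι) in
/-- The Reed–Muller code of functions on `k^ι` of degree at most `|ι| - j`, and `⊥` for `j > |ι|`.
The indexing makes `j ↦ reedMuller k ι j` a decreasing filtration. -/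
def reedMuller [Fintype ι] (j : ℕ) : Submodule k ((ι → k) → k) :=
  monomialSpan k {S : Finset ι | S.card + j ≤ Fintype.card ι}

theorem reedMuller_zero [Fintype ι] (hk : Nat.card k = 2) : reedMuller k ι 0 = ⊤ := by
  rw [← monomialSpan_univ hk, reedMuller]
  congr 1
  ext S
  simpa using Finset.card_le_univ S

theorem reedMuller_succ_le [Fintype ι] (j : ℕ) : reedMuller k ι (j + 1) ≤ reedMuller k ι j :=
  monomialSpan_mono fun S hS ↦ by
    simp only [Set.mem_ofPred_eq] at hS ⊢
    omega

theorem finrank_reedMuller [Fintype ι] (j : ℕ) :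
    finrank k (reedMuller k ι j) =
      finrank k (reedMuller k ι (j + 1)) + (Fintype.card ι).choose j := by
  classical
  have h (j : ℕ) : finrank k (reedMuller k ι j) =
      (Finset.univ.filter fun S : Finset ι ↦ S.card + j ≤ Fintype.card ι).card :=
    finrank_monomialSpan_filter _
  rw [h, h, ← card_filter_card_add_eq, ← Finset.card_union_of_disjoint]
  · congr 1
    ext S
    simp only [Finset.mem_filter, Finset.mem_univ, true_and, Finset.mem_union]
    omega
  · rw [Finset.disjoint_filter]
    intro S _ _
    omega

theorem reedMuller_translate_sub_mem [Fintype ι] (j : ℕ) (a : ι → k) {v : (ι → k) → k}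
    (hv : v ∈ reedMuller k ι j) :
    LinearMap.funLeft k k (fun x ↦ x + a) v - v ∈ reedMuller k ι (j + 1) := by
  have : reedMuller k ι j ≤
      (reedMuller k ι (j + 1)).comap (LinearMap.funLeft k k (fun x ↦ x + a) - LinearMap.id) := by
    refine Submodule.span_le.2 ?_
    rintro _ ⟨S, hS, rfl⟩
    refine monomialSpan_mono ?_ (squarefreeMonomial_translate_sub S a)
    intro T hT
    simp only [Set.mem_ofPred_eq] at hS hT ⊢
    omega
  exact this hv

/-- The Reed–Muller code is generated, as a translation-invariant subspace, by its monomials of top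
degree. -/
theorem reedMuller_le_of_top_le [Fintype ι] (j : ℕ) (N : Submodule k ((ι → k) → k))
    (htop : monomialSpan k {S : Finset ι | S.card + j = Fintype.card ι} ≤ N)
    (hN : ∀ a : ι → k, ∀ v ∈ reedMuller k ι j,
      LinearMap.funLeft k k (fun x ↦ x + a) v - v ∈ N) :
    reedMuller k ι j ≤ N := by
  classical
  refine Submodule.span_le.2 ?_
  rintro _ ⟨S, hS, rfl⟩
  rcases (Set.mem_ofPred.1 hS).eq_or_lt with h | h
  · exact htop (squarefreeMonomial_mem h)
  · obtain ⟨i, hi⟩ : ∃ i, i ∉ S := by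
      by_contra! hcon
      have := (Finset.eq_univ_iff_forall.2 hcon)
      rw [this, Finset.card_univ] at h
      omega
    rw [SetLike.mem_coe, ← squarefreeMonomial_insert_translate_sub hi]
    refine hN _ _ (squarefreeMonomial_mem ?_)
    rw [Set.mem_ofPred_eq, Finset.card_insert_of_notMem hi]
    omega

/-- The inequality relating the Betti numbers of `G` to the first Betti number of the kernel of a
surjection `G → k^ι`, for `k` the field with two elements. It is the bound
`homologyRank_one_ge_of_filtration` for the filtration of the functions on `k^ι` by Reed–Muller
codes. -/
theorem homologyRank_one_ker_ge {G : Type u} [Group G] [Fintype ι] (hk : Nat.card k = 2)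
    (f : G →* Multiplicative (ι → k)) (hf : Function.Surjective f)
    (hfin : FiniteLowHomology (Rep.trivial k G k))
    (hK : Module.Finite k (groupHomology (Rep.trivial k f.ker k) 1)) (l : ℕ) :
    (homologyRank (Rep.trivial k G k) 1 - 1 : ℤ) * (Fintype.card ι).choose l ≤
      homologyRank (Rep.trivial k f.ker k) 1 + (Fintype.card ι).choose (l + 1) +
        (homologyRank (Rep.trivial k G k) 2 - homologyRank (Rep.trivial k G k) 1 + 1) *
          ∑ i ∈ Finset.range l, ((Fintype.card ι).choose i : ℤ) := by
  classical
  have : Finite k := Nat.finite_of_card_ne_zero (by simp [hk])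
  have := Fintype.ofFinite k
  obtain ⟨e⟩ := nonempty_groupHomology_translation_equiv f hf 1
  have hM : Module.Finite k (groupHomology (Rep.of (translationRepresentation f)) 1) :=
    Module.Finite.equiv e.symm
  have key := homologyRank_one_ge_of_filtration (Rep.of (translationRepresentation f))
    (reedMuller k ι) (reedMuller_zero hk) reedMuller_succ_le
    (fun j g x hx ↦ reedMuller_translate_sub_mem j _ hx) _ finrank_reedMuller hfin hM l
    (monomialSpan k {S : Finset ι | S.card + (l + 1) = Fintype.card ι})
    (monomialSpan_mono fun S hS ↦ le_of_eq hS)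
    (fun N hUN hN ↦ reedMuller_le_of_top_le (l + 1) N hUN fun a v hv ↦ by
      obtain ⟨g, hg⟩ := hf (Multiplicative.ofAdd a)
      have := hN g v hv
      rw [show a = (f g).toAdd by rw [hg]; rfl]
      exact this)
  have hU : finrank k (monomialSpan k {S : Finset ι | S.card + (l + 1) = Fintype.card ι}) =
      (Fintype.card ι).choose (l + 1) := by
    rw [← card_filter_card_add_eq, finrank_monomialSpan_filter]
  rw [hU, show homologyRank (Rep.of (translationRepresentation f)) 1 = _ from
    e.finrank_eq] at key
  exact key

end ReedMuller

/-! ### First homology and homomorphisms to the field -/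

section FirstHomology

variable {k G : Type u} [Field k] [Group G]

/-- The surjection from `1`-chains with trivial coefficients onto `H₁(G; k)`. -/
noncomputable def chainsToH1 (k G : Type u) [Field k] [Group G] :
    (G →₀ k) →ₗ[k] groupHomology (Rep.trivial k G k) 1 :=
  (groupHomology.H1π (Rep.trivial k G k)).hom ∘ₗ
    (groupHomology.cycles₁IsoOfIsTrivial (Rep.trivial k G k)).inv.hom

theorem chainsToH1_surjective : Function.Surjective (chainsToH1 k G) :=
  ((ModuleCat.epi_iff_surjective _).1
    (inferInstance : Epi (groupHomology.H1π (Rep.trivial k G k)))).comp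
    (groupHomology.cycles₁IsoOfIsTrivial (Rep.trivial k G k)).symm.toLinearEquiv.surjective

theorem chainsToH1_eq_zero_iff (x : G →₀ k) :
    chainsToH1 k G x = 0 ↔ x ∈ groupHomology.boundaries₁ (Rep.trivial k G k) :=
  groupHomology.H1π_eq_zero_iff (A := Rep.trivial k G k) _

theorem chainsToH1_single_mul (g h : G) (a : k) :
    chainsToH1 k G (Finsupp.single (g * h) a) =
      chainsToH1 k G (Finsupp.single g a) + chainsToH1 k G (Finsupp.single h a) := by
  rw [← sub_eq_zero, ← map_add, ← map_sub, chainsToH1_eq_zero_iff]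
  refine ⟨-Finsupp.single (g, h) a, ?_⟩
  rw [map_neg, groupHomology.d₂₁_single (A := Rep.trivial k G k)]
  simp
  abel

/-- The dual of `H₁(G; k)` is the space of homomorphisms from `G` to `k`. -/
theorem nonempty_dual_H1_equiv :
    Nonempty (Module.Dual k (groupHomology (Rep.trivial k G k) 1) ≃ₗ[k] (Additive G →+ k)) := by
  let F : Module.Dual k (groupHomology (Rep.trivial k G k) 1) →ₗ[k] (Additive G →+ k) :=
    { toFun φ := AddMonoidHom.mk' (fun g ↦ φ (chainsToH1 k G (Finsupp.single g.toMul 1)))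
        fun g h ↦ by rw [toMul_add, chainsToH1_single_mul, map_add]
      map_add' _ _ := rfl
      map_smul' _ _ := rfl }
  have hF (φ) (g : Additive G) : F φ g = φ (chainsToH1 k G (Finsupp.single g.toMul 1)) := rfl
  refine ⟨LinearEquiv.ofBijective F ⟨?_, ?_⟩⟩
  · intro φ ψ h
    have : φ ∘ₗ chainsToH1 k G = ψ ∘ₗ chainsToH1 k G := by
      refine Finsupp.lhom_ext' fun g ↦ LinearMap.ext_ring ?_
      exact DFunLike.congr_fun h (Additive.ofMul g)
    refine LinearMap.ext fun x ↦ ?_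
    obtain ⟨y, rfl⟩ := chainsToH1_surjective x
    exact LinearMap.congr_fun this y
  · intro χ
    let ψ : (G →₀ k) →ₗ[k] k := Finsupp.linearCombination k fun g ↦ χ (Additive.ofMul g)
    have hψ : LinearMap.ker (chainsToH1 k G) ≤ LinearMap.ker ψ := by
      intro x hx
      obtain ⟨y, rfl⟩ := (chainsToH1_eq_zero_iff x).1 hx
      have : ψ ∘ₗ (groupHomology.d₂₁ (Rep.trivial k G k)).hom = 0 := by
        refine Finsupp.lhom_ext fun p a ↦ ?_
        have hd := groupHomology.d₂₁_single (A := Rep.trivial k G k) p a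
        rw [LinearMap.comp_apply]
        erw [hd]
        rw [map_add, map_sub]
        simp [ψ]
        ring
      exact LinearMap.congr_fun this y
    refine ⟨(LinearMap.ker (chainsToH1 k G)).liftQ ψ hψ ∘ₗ
      ((chainsToH1 k G).quotKerEquivOfSurjective chainsToH1_surjective).symm.toLinearMap, ?_⟩
    refine AddMonoidHom.ext fun g ↦ ?_
    have h2 : ((chainsToH1 k G).quotKerEquivOfSurjective chainsToH1_surjective).symm
        (chainsToH1 k G (Finsupp.single g.toMul 1)) =
        (LinearMap.ker (chainsToH1 k G)).mkQ (Finsupp.single g.toMul 1) := by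
      rw [LinearEquiv.symm_apply_eq]
      rfl
    rw [hF, LinearMap.comp_apply, LinearEquiv.coe_coe, h2, Submodule.mkQ_apply, Submodule.liftQ_apply]
    simp [ψ]

/-- The dimension of the space of homomorphisms from `G` to the field `k`. -/
noncomputable def homRank (k G : Type u) [Field k] [Group G] : ℕ := finrank k (Additive G →+ k)

instance [Group.FG G] [Finite k] : Finite (Additive G →+ k) := by
  obtain ⟨S, hS⟩ := Group.FG.out (G := G)
  refine Finite.of_injective (β := S → k) (fun χ s ↦ χ (Additive.ofMul (s : G))) ?_
  intro χ ψ h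
  have : (AddMonoidHom.toMultiplicativeRight χ) = AddMonoidHom.toMultiplicativeRight ψ := by
    refine MonoidHom.eq_of_eqOn_dense hS fun s hs ↦ ?_
    exact congrFun h ⟨s, hs⟩
  exact AddMonoidHom.toMultiplicativeRight.injective this

theorem finite_H1 [Group.FG G] [Finite k] :
    Module.Finite k (groupHomology (Rep.trivial k G k) 1) := by
  obtain ⟨e⟩ := nonempty_dual_H1_equiv (k := k) (G := G)
  rw [← Module.finite_dual_iff k]
  exact Module.Finite.equiv e.symm

theorem homologyRank_one_eq_homRank [Group.FG G] [Finite k] :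
    homologyRank (Rep.trivial k G k) 1 = homRank k G := by
  obtain ⟨e⟩ := nonempty_dual_H1_equiv (k := k) (G := G)
  have := finite_H1 (k := k) (G := G)
  rw [homRank, ← e.finrank_eq, Subspace.dual_finrank_eq]

theorem card_hom [Group.FG G] [Finite k] :
    Nat.card (Additive G →+ k) = Nat.card k ^ homRank k G := by
  rw [homRank, ← Module.natCard_eq_pow_finrank]

theorem homRank_congr {G' : Type u} [Group G'] (e : G ≃* G') : homRank k G = homRank k G' := by
  let F : (Additive G' →+ k) ≃ₗ[k] (Additive G →+ k) :=
    { toFun χ := χ.comp e.toMonoidHom.toAdditive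
      invFun χ := χ.comp e.symm.toMonoidHom.toAdditive
      left_inv χ := by ext; simp
      right_inv χ := by ext; simp
      map_add' _ _ := rfl
      map_smul' _ _ := rfl }
  exact F.finrank_eq.symm

/-- Passing to a subgroup of index `m` lowers the rank of the first homology by at most `m`. -/
theorem homRank_le_add_index [Group.FG G] [Finite k] (L : Subgroup G) [L.FiniteIndex] :
    homRank k G ≤ homRank k L + L.index := by
  let R : (Additive G →+ k) →ₗ[k] (Additive L →+ k) :=
    { toFun χ := χ.comp L.subtype.toAdditive
      map_add' _ _ := rfl
      map_smul' _ _ := rfl }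
  let E : (Additive G →+ k) →ₗ[k] (G ⧸ L → k) :=
    { toFun χ q := χ (Additive.ofMul q.out)
      map_add' _ _ := rfl
      map_smul' _ _ := rfl }
  have hE : Function.Injective (R.prod E) := by
    refine (injective_iff_map_eq_zero (R.prod E)).2 fun χ h ↦ AddMonoidHom.ext fun g ↦ ?_
    have hR (l : L) : χ (Additive.ofMul (l : G)) = 0 :=
      DFunLike.congr_fun (congrArg Prod.fst h) (Additive.ofMul l)
    have h1 : χ (Additive.ofMul (QuotientGroup.mk (s := L) g.toMul).out) = 0 :=
      congrFun (congrArg Prod.snd h) (QuotientGroup.mk g.toMul)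
    obtain ⟨l, hl⟩ := QuotientGroup.mk_out_eq_mul L g.toMul
    rw [hl, ofMul_mul, map_add, hR, add_zero] at h1
    exact h1
  have h2 := LinearMap.finrank_le_finrank_of_injective hE
  have h3 : finrank k (G ⧸ L → k) = L.index := by
    have := Fintype.ofFinite (G ⧸ L)
    rw [finrank_pi, ← Nat.card_eq_fintype_card]
    rfl
  rw [finrank_prod, h3] at h2
  exact h2

/-- Over the field with two elements, a basis of the homomorphisms to `k` gives a surjection onto a
power of `k`. -/
theorem exists_surjective_hom [Group.FG G] (hk : Nat.card k = 2) :
    ∃ f : G →* Multiplicative (Fin (homRank k G) → k), Function.Surjective f := by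
  have : Finite k := Nat.finite_of_card_ne_zero (by simp [hk])
  let b : Basis (Fin (homRank k G)) k (Additive G →+ k) := finBasis k (Additive G →+ k)
  let f : Additive G →+ (Fin (homRank k G) → k) :=
    { toFun g i := b i g
      map_zero' := by ext; simp
      map_add' _ _ := by ext; simp }
  have h01 (a : k) : a = 0 ∨ a = 1 := by
    by_contra! h
    have := Fintype.ofFinite k
    classical
    have h3 : ({0, 1, a} : Finset k).card = 3 := by
      rw [Finset.card_eq_three]
      exact ⟨0, 1, a, zero_ne_one, h.1.symm, h.2.symm, rfl⟩
    have h4 := Finset.card_le_univ ({0, 1, a} : Finset k)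
    rw [Nat.card_eq_fintype_card] at hk
    omega
  let V : Submodule k (Fin (homRank k G) → k) :=
    { f.range with
      smul_mem' a x hx := by
        rcases h01 a with rfl | rfl
        · simp
        · simpa using hx }
  have hV : V = ⊤ := by
    by_contra hne
    obtain ⟨φ, hφ, hφV⟩ := Submodule.exists_le_ker_of_lt_top V (lt_top_iff_ne_top.2 hne)
    have hsum : ∑ i, φ (Pi.single i 1) • b i = 0 := by
      refine AddMonoidHom.ext fun g ↦ ?_
      have h1 : φ (f g) = 0 := hφV ⟨g, rfl⟩
      have h2 : φ (f g) = ∑ i, f g i * φ (Pi.single i 1) := by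
        conv_lhs => rw [← Finset.univ_sum_single (f g)]
        rw [map_sum]
        refine Finset.sum_congr rfl fun i _ ↦ ?_
        rw [← smul_eq_mul, ← map_smul, ← Pi.single_smul, smul_eq_mul, mul_one]
      rw [h1] at h2
      simp only [AddMonoidHom.finsetSum_apply, AddMonoidHom.smul_apply, AddMonoidHom.zero_apply]
      rw [h2]
      exact Finset.sum_congr rfl fun i _ ↦ mul_comm _ _
    have hz := Fintype.linearIndependent_iff.1 b.linearIndependent _ hsum
    refine hφ (LinearMap.pi_ext' fun i ↦ LinearMap.ext_ring ?_)
    simpa using hz i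
  refine ⟨AddMonoidHom.toMultiplicativeRight f, fun x ↦ ?_⟩
  have : x.toAdd ∈ V := hV ▸ Submodule.mem_top
  obtain ⟨g, hg⟩ := this
  exact ⟨g.toMul, congrArg Multiplicative.ofAdd hg⟩

end FirstHomology

/-! ### Betti numbers modulo two -/

section Betti

/-- The field with two elements, lifted to the universe `u`. -/
abbrev F2 : Type u := ULift.{u} (ZMod 2)

theorem card_F2 : Nat.card F2.{u} = 2 := by
  rw [Nat.card_congr Equiv.ulift, Nat.card_zmod]

instance : Finite F2.{u} := Nat.finite_of_card_ne_zero (by simp)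

variable {G : Type u} [Group G]

theorem bettiNumber_one [Group.FG G] : bettiNumber 2 1 G = (homRank F2 G : ℕ∞) := by
  have := finite_H1 (k := F2.{u}) (G := G)
  rw [← homologyRank_one_eq_homRank, bettiNumber, homologyRank, ← finrank_eq_rank,
    Cardinal.toENat_nat]

theorem finiteLowHomology_of_bettiNumber_le [Group.FG G] {C : ℕ}
    (hC : bettiNumber 2 2 G ≤ bettiNumber 2 1 G + C) :
    FiniteLowHomology (Rep.trivial F2.{u} G F2.{u}) ∧
      homologyRank (Rep.trivial F2.{u} G F2.{u}) 2 ≤ homRank F2 G + C := by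
  rw [bettiNumber_one] at hC
  have h2 : Module.Finite F2.{u} (groupHomology (Rep.trivial F2.{u} G F2.{u}) 2) := by
    rw [← rank_lt_aleph0_iff, ← Cardinal.toENat_lt_top]
    exact hC.trans_lt (by exact_mod_cast ENat.natCast_lt_top _)
  refine ⟨fun i hi ↦ ?_, ?_⟩
  · interval_cases i
    · exact Module.Finite.equiv
        (groupHomology.H0IsoOfIsTrivial (Rep.trivial F2.{u} G F2.{u})).toLinearEquiv.symm
    · exact finite_H1
    · exact h2
  · rw [bettiNumber, ← finrank_eq_rank, Cardinal.toENat_nat] at hC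
    exact_mod_cast hC

end Betti

/-! ### Growth of the first Betti number -/

section Growth

theorem sixteen_pow_le_centralBinom_sq (m : ℕ) (hm : 0 < m) :
    16 ^ m ≤ m.centralBinom ^ 2 * (4 * m) := by
  induction m, hm using Nat.le_induction with
  | base => simp [Nat.centralBinom, Nat.choose]
  | succ m hm ih =>
    have h := Nat.succ_mul_centralBinom_succ m
    have h1 : (m + 1) * 16 ^ (m + 1) ≤
        (m + 1) * ((m + 1).centralBinom ^ 2 * (4 * (m + 1))) := by
      calc (m + 1) * 16 ^ (m + 1) = 16 * (m + 1) * 16 ^ m := by ring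
        _ ≤ 16 * (m + 1) * (m.centralBinom ^ 2 * (4 * m)) := by gcongr
        _ = (m.centralBinom ^ 2 * 16) * (4 * (m * (m + 1))) := by ring
        _ ≤ (m.centralBinom ^ 2 * 16) * (2 * m + 1) ^ 2 := by gcongr; nlinarith
        _ = 4 * (2 * (2 * m + 1) * m.centralBinom) ^ 2 := by ring
        _ = 4 * ((m + 1) * (m + 1).centralBinom) ^ 2 := by rw [h]
        _ = _ := by ring
    exact Nat.le_of_mul_le_mul_left h1 (by omega)

theorem four_pow_le_choose_half_sq (n : ℕ) :
    4 ^ n ≤ n.choose (n / 2) ^ 2 * (2 * (n + 1)) := by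
  obtain ⟨m, rfl | rfl⟩ := n.even_or_odd'
  · rcases m.eq_zero_or_pos with rfl | hm
    · simp
    · have := sixteen_pow_le_centralBinom_sq m hm
      rw [Nat.centralBinom] at this
      rw [show 2 * m / 2 = m by omega, pow_mul]
      norm_num
      exact this.trans (Nat.mul_le_mul_left _ (by omega))
  · have := sixteen_pow_le_centralBinom_sq (m + 1) (by omega)
    have h2 : (m + 1).centralBinom = 2 * (2 * m + 1).choose m := by
      rw [Nat.centralBinom, show 2 * (m + 1) = 2 * m + 1 + 1 by ring, Nat.choose_succ_succ,
        Nat.choose_symm_half]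
      ring
    rw [h2] at this
    rw [show (2 * m + 1) / 2 = m by omega, pow_succ, pow_mul]
    norm_num
    have h3 : (16 : ℕ) ^ (m + 1) = 16 * 16 ^ m := by ring
    rw [h3] at this
    nlinarith

variable {G : Type u} [Group G]

/-- The kernel of the map from `G` to `H₁(G; 𝔽₂)` has large first Betti number when
`b₂(G) - b₁(G)` is bounded. -/
theorem exists_normal_homRank_ge [Group.FG G] {C : ℕ}
    (hC : bettiNumber 2 2 G ≤ bettiNumber 2 1 G + C)
    (hn : 100 * (C + 1) ^ 2 ≤ homRank F2.{u} G) :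
    ∃ K : Subgroup G, K.Normal ∧ K.index = 2 ^ homRank F2.{u} G ∧
      √(homRank F2.{u} G) / 2 * 2 ^ homRank F2.{u} G ≤ (homRank F2.{u} K : ℝ) := by
  obtain ⟨f, hf⟩ := exists_surjective_hom (G := G) card_F2
  obtain ⟨hfin, hb2⟩ := finiteLowHomology_of_bettiNumber_le hC
  have hindex : f.ker.index = 2 ^ homRank F2.{u} G := by
    rw [Subgroup.index_ker, MonoidHom.range_eq_top.2 hf, Subgroup.card_top,
      Nat.card_congr Multiplicative.toAdd, Nat.card_fun, card_F2, Nat.card_fin]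
  refine ⟨f.ker, inferInstance, hindex, ?_⟩
  have : f.ker.FiniteIndex := ⟨by rw [hindex]; positivity⟩
  have key := homologyRank_one_ker_ge card_F2 f hf hfin finite_H1 (homRank F2.{u} G / 2)
  rw [homologyRank_one_eq_homRank, homologyRank_one_eq_homRank, Fintype.card_fin] at key
  generalize homRank F2.{u} f.ker = b at key ⊢
  clear! f
  generalize homologyRank (Rep.trivial F2.{u} G F2.{u}) 2 = β at key hb2
  generalize homRank F2.{u} G = n at *
  have h1 : (n.choose (n / 2 + 1) : ℝ) ≤ n.choose (n / 2) := by
    exact_mod_cast Nat.choose_le_middle _ _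
  have h2 : ∑ i ∈ Finset.range (n / 2), (n.choose i : ℝ) ≤ 2 ^ n := by
    rw [← Nat.cast_sum]
    have : ∑ i ∈ Finset.range (n / 2), n.choose i ≤ 2 ^ n := by
      rw [← Nat.sum_range_choose]
      exact Finset.sum_le_sum_of_subset (Finset.range_subset_range.2 (by omega))
    exact_mod_cast this
  have h2' : 0 ≤ ∑ i ∈ Finset.range (n / 2), (n.choose i : ℝ) := by positivity
  have h3 : ((n : ℝ) - 1) * n.choose (n / 2) ≤
      b + n.choose (n / 2 + 1) +
        ((β : ℝ) - n + 1) * ∑ i ∈ Finset.range (n / 2), (n.choose i : ℝ) := by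
    exact_mod_cast key
  have h4 : (β : ℝ) - n + 1 ≤ C + 1 := by
    have : (β : ℝ) ≤ n + C := by exact_mod_cast hb2
    linarith
  have h5 : ((n : ℝ) - 2) * n.choose (n / 2) ≤ b + (C + 1) * 2 ^ n := by
    have : ((β : ℝ) - n + 1) * ∑ i ∈ Finset.range (n / 2), (n.choose i : ℝ) ≤
        (C + 1) * 2 ^ n :=
      (mul_le_mul_of_nonneg_right h4 h2').trans (by gcongr)
    linarith
  have hn' : 100 * ((C : ℝ) + 1) ^ 2 ≤ n := by exact_mod_cast hn
  have hn100 : (100 : ℝ) ≤ n := by nlinarith [(Nat.cast_nonneg C : (0 : ℝ) ≤ C)]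
  have h6 : (2 : ℝ) ^ n ≤ n.choose (n / 2) * √(2 * (n + 1)) := by
    have h : ((4 : ℝ) ^ n) ≤ n.choose (n / 2) ^ 2 * (2 * (n + 1)) := by
      exact_mod_cast four_pow_le_choose_half_sq n
    refine le_of_sq_le_sq ?_ (by positivity)
    rw [mul_pow, Real.sq_sqrt (by positivity), ← pow_mul, mul_comm n 2, pow_mul]
    norm_num
    exact h
  have h7 : 6 / 10 * √n * √(2 * (n + 1)) ≤ (n : ℝ) - 2 := by
    refine le_of_sq_le_sq ?_ (by linarith)
    rw [mul_pow, mul_pow, Real.sq_sqrt (by positivity), Real.sq_sqrt (by positivity)]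
    nlinarith
  have h8 : (C : ℝ) + 1 ≤ √n / 10 := by
    rw [le_div_iff₀ (by norm_num)]
    refine Real.le_sqrt_of_sq_le ?_
    nlinarith
  have h9 : 6 / 10 * √n * 2 ^ n ≤ ((n : ℝ) - 2) * n.choose (n / 2) := by
    calc 6 / 10 * √n * 2 ^ n ≤ 6 / 10 * √n * (n.choose (n / 2) * √(2 * (n + 1))) := by gcongr
      _ = 6 / 10 * √n * √(2 * (n + 1)) * n.choose (n / 2) := by ring
      _ ≤ _ := by gcongr
  have h10 : ((C : ℝ) + 1) * 2 ^ n ≤ √n / 10 * 2 ^ n := by gcongr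
  linarith

/-- The version of `exists_normal_homRank_ge` for a finite index subgroup `H`. -/
theorem exists_le_homRank_ge [Group.FG G] {C : ℕ} (H : Subgroup G) [H.FiniteIndex]
    (hC : bettiNumber 2 2 H ≤ bettiNumber 2 1 H + C)
    (hn : 100 * (C + 1) ^ 2 ≤ homRank F2.{u} H) :
    ∃ K ≤ H, (K.subgroupOf H).Normal ∧ K.FiniteIndex ∧
      K.index = H.index * 2 ^ homRank F2.{u} H ∧
      √(homRank F2.{u} H) / 2 * 2 ^ homRank F2.{u} H ≤ (homRank F2.{u} K : ℝ) := by
  obtain ⟨K, hK, hi, hr⟩ := exists_normal_homRank_ge hC hn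
  have hidx : (K.map H.subtype).index = H.index * 2 ^ homRank F2.{u} H := by
    rw [Subgroup.index_map_subtype, hi, mul_comm]
  have hsub : (K.map H.subtype).subgroupOf H = K := by
    rw [Subgroup.subgroupOf, Subgroup.comap_map_eq_self_of_injective H.subtype_injective]
  refine ⟨K.map H.subtype, Subgroup.map_subtype_le K, by rwa [hsub], ⟨?_⟩, hidx, ?_⟩
  · rw [hidx]
    have := Subgroup.FiniteIndex.index_ne_zero (H := H)
    positivity
  · rw [← homRank_congr (K.equivMapOfInjective H.subtype H.subtype_injective)]
    exact hr

end Growth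

/-! ### Counting subgroups -/

section Counting

variable {G : Type u} [Group G]

theorem finite_monoidHom_of_fg [Group.FG G] (P : Type*) [Group P] [Finite P] :
    Finite (G →* P) := by
  obtain ⟨S, hS⟩ := Group.FG.out (G := G)
  exact Finite.of_injective (β := S → P) (fun φ s ↦ φ s) fun φ ψ h ↦
    MonoidHom.eq_of_eqOn_dense hS fun s hs ↦ congrFun h ⟨s, hs⟩

/-- A finitely generated group has finitely many subgroups of index at most `n`: each is a point
stabilizer of an action on a set with at most `n` elements. -/
theorem finite_setOf_index_le [Group.FG G] (n : ℕ) :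
    {H : Subgroup G | H.FiniteIndex ∧ H.index ≤ n}.Finite := by
  have hfin (m : ℕ) : (Set.range fun p : (G →* Equiv.Perm (Fin m)) × Fin m ↦
      (MulAction.stabilizer (Equiv.Perm (Fin m)) p.2).comap p.1).Finite := by
    have := finite_monoidHom_of_fg (G := G) (Equiv.Perm (Fin m))
    exact Set.finite_range _
  refine ((Set.finite_Iic n).biUnion fun m _ ↦ hfin m).subset ?_
  rintro H ⟨hH, hn⟩
  refine Set.mem_biUnion (show H.index ∈ Set.Iic n from hn) ?_
  let e : G ⧸ H ≃ Fin H.index := Finite.equivFin (G ⧸ H)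
  refine ⟨(e.permCongrHom.toMonoidHom.comp (MulAction.toPermHom G (G ⧸ H)),
    e (QuotientGroup.mk 1)), ?_⟩
  ext g
  have h1 : g • (QuotientGroup.mk 1 : G ⧸ H) = QuotientGroup.mk 1 ↔ g ∈ H := by
    rw [MulAction.Quotient.smul_mk, smul_eq_mul, mul_one, eq_comm, QuotientGroup.eq]
    simp
  rw [← h1]
  simp [MulAction.mem_stabilizer_iff, Equiv.permCongrHom]

theorem subnormalSubgroupCount_le_subgroupCount [Group.FG G] (n : ℕ) :
    subnormalSubgroupCount G n ≤ subgroupCount G n :=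
  Set.ncard_le_ncard (fun _ h ↦ h.2) (finite_setOf_index_le n)

theorem eq_of_ne_zero_of_card_eq_two {k : Type*} [Zero k] (hk : Nat.card k = 2) {a b : k}
    (ha : a ≠ 0) (hb : b ≠ 0) : a = b := by
  obtain ⟨x, y, -, hu⟩ := Nat.card_eq_two_iff.1 hk
  have h (c : k) : c = x ∨ c = y := by
    have : c ∈ ({x, y} : Set k) := hu ▸ Set.mem_univ c
    simpa using this
  rcases h a with rfl | rfl <;> rcases h b with rfl | rfl <;> rcases h 0 with h0 | h0 <;>
    simp_all

/-- The kernels of the homomorphisms from a subnormal subgroup `H` to `𝔽₂` are subnormal subgroups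
of index at most `2 [G : H]`. -/
theorem two_pow_homRank_le_subnormalSubgroupCount [Group.FG G] (H : Subgroup G) [H.FiniteIndex]
    (hH : H.IsSubnormal) :
    2 ^ homRank F2.{u} H ≤ subnormalSubgroupCount G (2 * H.index) := by
  let κ (χ : Additive H →+ F2.{u}) : Subgroup H := (AddMonoidHom.toMultiplicativeRight χ).ker
  have hmem (χ) (h : H) : h ∈ κ χ ↔ χ (Additive.ofMul h) = 0 := Iff.rfl
  have hκ : Function.Injective fun χ ↦ (κ χ).map H.subtype := by
    intro χ ψ h
    have h1 : κ χ = κ ψ := Subgroup.map_injective H.subtype_injective h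
    refine AddMonoidHom.ext fun g ↦ ?_
    have h2 : χ g = 0 ↔ ψ g = 0 := by
      rw [← ofMul_toMul g, ← hmem, ← hmem, h1]
    by_cases h3 : χ g = 0
    · rw [h3, h2.1 h3]
    · exact eq_of_ne_zero_of_card_eq_two card_F2 h3 (mt h2.2 h3)
  have hcard : Nat.card (Additive H →+ F2.{u}) = 2 ^ homRank F2.{u} H := by
    rw [card_hom, card_F2]
  rw [← hcard, ← Set.ncard_range_of_injective hκ]
  refine Set.ncard_le_ncard ?_ ((finite_setOf_index_le (2 * H.index)).subset fun _ h ↦ h.2)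
  rintro _ ⟨χ, rfl⟩
  have hi : (κ χ).index ≤ 2 ∧ (κ χ).index ≠ 0 := by
    have hfin : Finite (AddMonoidHom.toMultiplicativeRight χ).range :=
      Finite.of_injective (β := F2.{u}) (fun x ↦ x.1.toAdd) fun x y h ↦ Subtype.ext h
    rw [Subgroup.index_ker]
    refine ⟨?_, Nat.card_pos.ne'⟩
    exact (Nat.card_le_card_of_injective (β := F2.{u}) (fun x ↦ x.1.toAdd)
      fun x y h ↦ Subtype.ext h).trans_eq card_F2
  have hidx : ((κ χ).map H.subtype).index = (κ χ).index * H.index := Subgroup.index_map_subtype _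
  refine ⟨?_, ⟨?_⟩, ?_⟩
  · refine Subgroup.IsSubnormal.step _ H (Subgroup.map_subtype_le _) hH ?_
    rw [Subgroup.subgroupOf, Subgroup.comap_map_eq_self_of_injective H.subtype_injective]
    exact MonoidHom.normal_ker _
  · rw [hidx]
    exact mul_ne_zero hi.2 Subgroup.FiniteIndex.index_ne_zero
  · rw [hidx]
    exact Nat.mul_le_mul_right _ hi.1

end Counting

/-! ### Iterating the growth of the first Betti number -/

section Iteration

theorem two_pow_le_of_sqrt_le {n m : ℕ} (hn : 100 ≤ n)
    (h : √(n : ℝ) / 2 * 2 ^ n ≤ (m : ℝ)) : 2 ^ n ≤ m := by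
  have h1 : (2 : ℝ) ≤ √(n : ℝ) := Real.le_sqrt_of_sq_le (by norm_num; exact_mod_cast (by omega))
  have h2 : (2 : ℝ) ^ n ≤ √(n : ℝ) / 2 * 2 ^ n := by
    have : (0 : ℝ) < 2 ^ n := by positivity
    nlinarith
  exact_mod_cast h2.trans h

variable {G : Type u} [Group G]

/-- The tower of subgroups, each normal in the preceding one, obtained by iterating `exists_le_homRank_ge`. -/
theorem exists_tower [Group.FG G] {C : ℕ}
    (hC : ∀ H : Subgroup G, H.FiniteIndex → bettiNumber 2 2 H ≤ bettiNumber 2 1 H + C)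
    (H : Subgroup G) [hf : H.FiniteIndex] (hn : 100 * (C + 1) ^ 2 ≤ homRank F2.{u} H) :
    ∃ K : ℕ → Subgroup G, K 0 = H ∧ (∀ i, (K i).FiniteIndex) ∧
      (∀ i, K (i + 1) ≤ K i ∧ ((K (i + 1)).subgroupOf (K i)).Normal) ∧
      (∀ i, (K (i + 1)).index = (K i).index * 2 ^ homRank F2.{u} (K i)) ∧
      (∀ i, 100 ≤ homRank F2.{u} (K i)) ∧
      ∀ i, √(homRank F2.{u} (K i)) / 2 * 2 ^ homRank F2.{u} (K i) ≤
        (homRank F2.{u} (K (i + 1)) : ℝ) := by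
  have h100 : 100 ≤ 100 * (C + 1) ^ 2 := Nat.le_mul_of_pos_right _ (by positivity)
  let P := {H : Subgroup G // H.FiniteIndex ∧ 100 * (C + 1) ^ 2 ≤ homRank F2.{u} H}
  have hstep (p : P) : ∃ q : P, q.1 ≤ p.1 ∧ (q.1.subgroupOf p.1).Normal ∧
      q.1.index = p.1.index * 2 ^ homRank F2.{u} p.1 ∧
      √(homRank F2.{u} p.1) / 2 * 2 ^ homRank F2.{u} p.1 ≤ (homRank F2.{u} q.1 : ℝ) := by
    obtain ⟨H, hf, hn⟩ := p
    obtain ⟨K, h1, h2, h3, h4, h5⟩ := exists_le_homRank_ge H (hC H hf) hn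
    have h6 := two_pow_le_of_sqrt_le (h100.trans hn) h5
    exact ⟨⟨K, h3, (hn.trans Nat.lt_two_pow_self.le).trans h6⟩, h1, h2, h4, h5⟩
  choose next hnext using hstep
  let K : ℕ → P := fun i ↦ next^[i] ⟨H, hf, hn⟩
  have hK (i) : K (i + 1) = next (K i) := Function.iterate_succ_apply' _ _ _
  refine ⟨fun i ↦ (K i).1, rfl, fun i ↦ (K i).2.1, fun i ↦ ?_, fun i ↦ ?_,
    fun i ↦ h100.trans (K i).2.2, fun i ↦ ?_⟩
  · simp only [hK]
    exact ⟨(hnext (K i)).1, (hnext (K i)).2.1⟩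
  · simp only [hK]
    exact (hnext (K i)).2.2.1
  · beta_reduce
    rw [hK]
    exact (hnext (K i)).2.2.2

theorem le_of_two_pow_le {n : ℕ → ℕ} (h : ∀ i, 2 ^ n i ≤ n (i + 1)) (i : ℕ) : i ≤ n i := by
  induction i with
  | zero => exact Nat.zero_le _
  | succ i ih => exact (Nat.lt_two_pow_self.trans_le (h i)).trans_le' (by omega)

/-- If some finite index subgroup has large first Betti number, then there are *subnormal* subgroups
of finite index with arbitrarily large first Betti number: intersect the tower below the given
subgroup with its normal core, which only costs a bounded amount. -/
theorem exists_isSubnormal_homRank_ge [Group.FG G] {C : ℕ}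
    (hC : ∀ H : Subgroup G, H.FiniteIndex → bettiNumber 2 2 H ≤ bettiNumber 2 1 H + C)
    (H : Subgroup G) [H.FiniteIndex] (hn : 100 * (C + 1) ^ 2 ≤ homRank F2.{u} H) (T : ℕ) :
    ∃ K : Subgroup G, K.IsSubnormal ∧ K.FiniteIndex ∧ T ≤ homRank F2.{u} K := by
  obtain ⟨K, hK0, hKf, hKn, -, h100, hKg⟩ := exists_tower hC H hn
  let L := H.normalCore
  have hsub (i) : (K i ⊓ L).IsSubnormal := by
    induction i with
    | zero =>
      rw [hK0, inf_eq_right.2 H.normalCore_le]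
      exact Subgroup.Normal.isSubnormal inferInstance
    | succ i ih =>
      refine Subgroup.IsSubnormal.step _ (K i ⊓ L) (inf_le_inf_right L (hKn i).1) ih ?_
      have := (hKn i).2
      exact Subgroup.inf_subgroupOf_inf_normal_of_left L
  set i := T + L.index
  have hi : i ≤ homRank F2.{u} (K i) :=
    le_of_two_pow_le (n := fun i ↦ homRank F2.{u} (K i))
      (fun i ↦ two_pow_le_of_sqrt_le (h100 i) (hKg i)) i
  have hf := hKf i
  refine ⟨K i ⊓ L, hsub i, inferInstance, ?_⟩
  have h1 := homRank_le_add_index (k := F2.{u}) ((K i ⊓ L).subgroupOf (K i))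
  rw [homRank_congr (Subgroup.subgroupOfEquivOfLe inf_le_left)] at h1
  have h2 : ((K i ⊓ L).subgroupOf (K i)).index ≤ L.index := by
    change (K i ⊓ L).relIndex (K i) ≤ _
    rw [Subgroup.inf_relIndex_left]
    exact Nat.le_of_dvd (Nat.pos_of_ne_zero Subgroup.FiniteIndex.index_ne_zero)
      (Subgroup.relIndex_dvd_index_of_normal L (K i))
  omega

end Iteration

/-! ### Asymptotics -/

section Asymptotics

/-- Numerical heart of the final estimate. Here `z ≤ a ≤ b ≤ c` are successive Betti numbers in the
tower and `N` is the index of the subgroup with Betti number `z`. -/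
theorem index_div_lt {z a b c N : ℕ} (hz : 100 ≤ z) (hz6 : 576 * z ^ 6 < 2 ^ z)
    (hN0 : 0 < N) (hN : N ≤ z ^ 3)
    (ha : √(z : ℝ) / 2 * 2 ^ z ≤ (a : ℝ)) (hb : √(a : ℝ) / 2 * 2 ^ a ≤ (b : ℝ))
    (hc : √(b : ℝ) / 2 * 2 ^ b ≤ (c : ℝ)) {X : ℝ} (hX : X = 2 * (N * 2 ^ z * 2 ^ a * 2 ^ b)) :
    X / (√(Real.log X) * Real.log (Real.log X)) < c := by
  have hza := two_pow_le_of_sqrt_le hz ha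
  have ha100 : 100 ≤ a := hz.trans (Nat.lt_two_pow_self.le.trans hza)
  have hab := two_pow_le_of_sqrt_le ha100 hb
  have hb100 : 100 ≤ b := ha100.trans (Nat.lt_two_pow_self.le.trans hab)
  have hN1 : (1 : ℝ) ≤ N := by exact_mod_cast hN0
  have hlog2 : (1 / 2 : ℝ) ≤ Real.log 2 := by linarith [Real.log_two_gt_d9]
  have haR : (100 : ℝ) ≤ a := by exact_mod_cast ha100
  have hbR : (100 : ℝ) ≤ b := by exact_mod_cast hb100
  have hXb : (2 : ℝ) ^ b ≤ X := by
    have h1 : (1 : ℝ) ≤ 2 * (N * 2 ^ z * 2 ^ a) := by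
      have h2 : (1 : ℝ) ≤ 2 ^ z := one_le_pow₀ (by norm_num)
      have h3 : (1 : ℝ) ≤ 2 ^ a := one_le_pow₀ (by norm_num)
      have h4 : (1 : ℝ) ≤ N * 2 ^ z := one_le_mul_of_one_le_of_one_le hN1 h2
      have h5 : (1 : ℝ) ≤ N * 2 ^ z * 2 ^ a := one_le_mul_of_one_le_of_one_le h4 h3
      linarith
    calc (2 : ℝ) ^ b = 1 * 2 ^ b := (one_mul _).symm
      _ ≤ 2 * (N * 2 ^ z * 2 ^ a) * 2 ^ b := by gcongr
      _ = X := by rw [hX]; ring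
  have hX0 : 0 < X := lt_of_lt_of_le (by positivity) hXb
  have hlogX : (b : ℝ) / 2 ≤ Real.log X := by
    have h1 := Real.log_le_log (by positivity) hXb
    rw [Real.log_pow] at h1
    nlinarith
  have hsa : (4 : ℝ) ≤ √(a : ℝ) := Real.le_sqrt_of_sq_le (by linarith)
  have hb2 : (2 : ℝ) ^ a ≤ (b : ℝ) / 2 := by
    have : (0 : ℝ) < 2 ^ a := by positivity
    nlinarith
  have hloglogX : (a : ℝ) / 2 ≤ Real.log (Real.log X) := by
    have h1 := Real.log_le_log (by positivity) (hb2.trans hlogX)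
    rw [Real.log_pow] at h1
    nlinarith
  have hsqrtX : √((b : ℝ) / 2) ≤ √(Real.log X) := Real.sqrt_le_sqrt hlogX
  have hsb : 2 / 3 * √(b : ℝ) ≤ √((b : ℝ) / 2) := by
    refine Real.le_sqrt_of_sq_le ?_
    rw [mul_pow, Real.sq_sqrt (by positivity)]
    linarith
  have hD : 2 / 3 * √(b : ℝ) * (a / 2) ≤ √(Real.log X) * Real.log (Real.log X) :=
    mul_le_mul (hsb.trans hsqrtX) hloglogX (by positivity) (by positivity)
  have hD0 : 0 < √(Real.log X) * Real.log (Real.log X) :=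
    lt_of_lt_of_le (by positivity) hD
  rw [div_lt_iff₀ hD0]
  -- the index `N * 2 ^ z` is small compared with `a ^ (3 / 2)`
  have hNa : 24 * (N * 2 ^ z : ℝ) < a * √(a : ℝ) := by
    have h1 : (2 : ℝ) ^ z ≤ a := by exact_mod_cast hza
    have h2 : 24 * (z : ℝ) ^ 3 < √(a : ℝ) := by
      refine Real.lt_sqrt_of_sq_lt ?_
      calc (24 * (z : ℝ) ^ 3) ^ 2 = 576 * z ^ 6 := by ring
        _ < 2 ^ z := by exact_mod_cast hz6
        _ ≤ a := h1
    have h3 : (N : ℝ) ≤ z ^ 3 := by exact_mod_cast hN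
    have h4 : 24 * (N : ℝ) < √(a : ℝ) := by
      have : (0 : ℝ) ≤ (z : ℝ) ^ 3 := by positivity
      linarith
    calc 24 * (N * 2 ^ z : ℝ) = 2 ^ z * (24 * N) := by ring
      _ < 2 ^ z * √(a : ℝ) := by gcongr
      _ ≤ a * √(a : ℝ) := by gcongr
  calc X = 2 / 24 * (24 * (N * 2 ^ z)) * (2 ^ a * 2 ^ b) := by rw [hX]; ring
    _ < 2 / 24 * (a * √(a : ℝ)) * (2 ^ a * 2 ^ b) := by gcongr
    _ = 1 / 6 * a * 2 ^ b * (√(a : ℝ) / 2 * 2 ^ a) := by ring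
    _ ≤ 1 / 6 * a * 2 ^ b * b := by gcongr
    _ = √(b : ℝ) * √(b : ℝ) * (1 / 6 * a * 2 ^ b) := by
      rw [Real.mul_self_sqrt (by positivity)]; ring
    _ = √(b : ℝ) / 2 * 2 ^ b * (2 / 3 * √(b : ℝ) * (a / 2)) := by ring
    _ ≤ c * (√(Real.log X) * Real.log (Real.log X)) := by gcongr

/-- The largeness condition on `z` in `index_div_lt`. -/
theorem eventually_mul_pow_lt_two_pow : ∀ᶠ z : ℕ in Filter.atTop, 576 * z ^ 6 < 2 ^ z := by
  have h := tendsto_pow_const_div_const_pow_of_one_lt 6 (r := (2 : ℝ)) (by norm_num)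
  filter_upwards [h.eventually (gt_mem_nhds (show (0 : ℝ) < 1 / 576 by norm_num))] with z hz
  rw [div_lt_iff₀ (by positivity)] at hz
  have : (576 : ℝ) * z ^ 6 < 2 ^ z := by linarith
  exact_mod_cast this

/-- Deep in the tower, the Betti number `n i` beats the target exponent at twice the index `N i`. -/
theorem exists_index_div_lt {n N : ℕ → ℕ} (hn : ∀ i, 100 ≤ n i) (hN0 : 0 < N 0)
    (hN : ∀ i, N (i + 1) = N i * 2 ^ n i)
    (hg : ∀ i, √(n i : ℝ) / 2 * 2 ^ n i ≤ (n (i + 1) : ℝ)) (B : ℕ) :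
    ∃ i, B < 2 * N i ∧
      ((2 * N i : ℕ) : ℝ) / (√(Real.log ((2 * N i : ℕ) : ℝ)) *
        Real.log (Real.log ((2 * N i : ℕ) : ℝ))) < n i := by
  have hpow (i) : 2 ^ n i ≤ n (i + 1) := two_pow_le_of_sqrt_le (hn i) (hg i)
  have hNpos (i) : 0 < N i := by
    induction i with
    | zero => exact hN0
    | succ i ih => rw [hN]; positivity
  have hsq (m : ℕ) (hm : 100 ≤ m) : m ^ 2 ≤ 2 ^ m := by
    induction m, hm using Nat.le_induction with
    | base => norm_num
    | succ m hm ih => rw [pow_succ 2 m]; nlinarith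
  -- the index is at most quadratic in the Betti number
  have hquad (i) : N i ≤ N 0 * n i ^ 2 := by
    induction i with
    | zero => exact Nat.le_mul_of_pos_right _ (pow_pos (by have := hn 0; omega) 2)
    | succ i ih =>
      calc N (i + 1) = N i * 2 ^ n i := hN i
        _ ≤ N 0 * n i ^ 2 * 2 ^ n i := by gcongr
        _ ≤ N 0 * 2 ^ n i * 2 ^ n i := 
          Nat.mul_le_mul_right _ (Nat.mul_le_mul_left _ (hsq _ (hn i)))
        _ = N 0 * (2 ^ n i) ^ 2 := by ring
        _ ≤ N 0 * n (i + 1) ^ 2 := by gcongr; exact hpow i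
  obtain ⟨Z, hZ⟩ := Filter.eventually_atTop.1 eventually_mul_pow_lt_two_pow
  set i := Z + N 0 + B with hi
  have hin : i ≤ n i := le_of_two_pow_le hpow i
  have hN3 : N (i + 3) = N i * 2 ^ n i * 2 ^ n (i + 1) * 2 ^ n (i + 2) := by
    rw [hN, hN, hN]
  refine ⟨i + 3, ?_, ?_⟩
  · have h1 : 2 ^ n i ≤ N (i + 3) := by
      rw [hN3]
      have h2 : 2 ^ n i ≤ N i * 2 ^ n i := Nat.le_mul_of_pos_left _ (hNpos i)
      exact h2.trans ((Nat.le_mul_of_pos_right _ (by positivity)).trans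
        (Nat.le_mul_of_pos_right _ (by positivity)))
    have h2 : n i < 2 ^ n i := Nat.lt_two_pow_self
    omega
  · -- with `a = n (i + 1)`, `log log` of the index at `i + 3` is at least `a / 2`, and `√a`, which
    -- is at least `2 ^ (n i / 2)`, absorbs `N i`
    refine index_div_lt (hn i) (hZ _ (by omega)) (hNpos i) ?_ (hg i) (hg (i + 1)) (hg (i + 2)) ?_
    · calc N i ≤ N 0 * n i ^ 2 := hquad i
        _ ≤ n i * n i ^ 2 := by gcongr; omega
        _ = n i ^ 3 := by ring
    · rw [hN3]
      push_cast
      ring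

end Asymptotics

theorem theorem1p1 (G : Type u) [Group G] [Group.FG G]
    (hG : HasB2SubB1Property 2 G)
    (hsup : (⨆ (H : Subgroup G) (_ : H.FiniteIndex), bettiNumber 2 1 H) = ⊤) :
    {n : ℕ | subnormalSubgroupCount G n ≤ subgroupCount G n ∧
      (2 : ℝ) ^ ((n : ℝ) / (Real.sqrt (Real.log n) * Real.log (Real.log n))) <
        (subnormalSubgroupCount G n : ℝ)}.Infinite := by
  obtain ⟨C, hC⟩ := hG
  set T := 100 * (C + 1) ^ 2 with hT
  -- a finite index subgroup with large first Betti number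
  obtain ⟨H, hHf, hHT⟩ : ∃ H : Subgroup G, H.FiniteIndex ∧ T ≤ homRank F2.{u} H := by
    have h1 : (T : ℕ∞) < ⨆ (H : Subgroup G) (_ : H.FiniteIndex), bettiNumber 2 1 H := by
      rw [hsup]; exact ENat.natCast_lt_top T
    obtain ⟨H, hH⟩ := lt_iSup_iff.1 h1
    obtain ⟨hf, hH⟩ := lt_iSup_iff.1 hH
    rw [bettiNumber_one] at hH
    exact ⟨H, hf, by exact_mod_cast hH.le⟩
  -- a subnormal one, from which the tower consists of subnormal subgroups
  obtain ⟨H', hsn, hf', hT'⟩ := exists_isSubnormal_homRank_ge hC H hHT T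
  obtain ⟨K, hK0, hKf, hKn, hKi, h100, hKg⟩ := exists_tower hC H' hT'
  have hsub (i) : (K i).IsSubnormal := by
    induction i with
    | zero => rwa [hK0]
    | succ i ih => exact Subgroup.IsSubnormal.step _ (K i) (hKn i).1 ih (hKn i).2
  refine Set.infinite_of_forall_exists_gt fun B ↦ ?_
  obtain ⟨i, hB, hlt⟩ := exists_index_div_lt (n := fun i ↦ homRank F2.{u} (K i))
    (N := fun i ↦ (K i).index) h100 (Nat.pos_of_ne_zero (hKf 0).index_ne_zero) hKi hKg B
  refine ⟨2 * (K i).index, ⟨subnormalSubgroupCount_le_subgroupCount _, ?_⟩, hB⟩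
  have := hKf i
  calc _ < (2 : ℝ) ^ ((homRank F2.{u} (K i) : ℕ) : ℝ) :=
        Real.rpow_lt_rpow_of_exponent_lt (by norm_num) hlt
    _ = ((2 ^ homRank F2.{u} (K i) : ℕ) : ℝ) := by rw [Real.rpow_natCast]; push_cast; rfl
    _ ≤ _ := by exact_mod_cast two_pow_homRank_le_subnormalSubgroupCount (K i) (hsub i)
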